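/- Let $m,n$ be positive integers and let $\mathbb{P}(\mathrm{Mat}_{m,n})$ be the complex projective space of $m\times n$ matrices, with the matrix entries as homogeneous coordinates. For $1\le r\le\min\{m,n\}$ let $X_r\subset\mathbb{P}(\mathrm{Mat}_{m,n})$ be the projective variety of (classes of nonzero) matrices of rank at most $r$. For $X,Y\subset\mathbb{P}^N$ let $$X\star Y:=\overline{\{p\star q : p\in X,\ q\in Y,\ p\star q \text{ is defined}\}}\subset\mathbb{P}^N$$ (Zariski closure), where $[p_0:\cdots:p_N]\star[q_0:\cdots:q_N]=[p_0q_0:\cdots:p_Nq_N]$ is defined when some $p_iq_i\neq0$. Define the Hadamard powers of $X$ by $X^{\star 0}:=\{[1:\cdots:1]\}$ and $X^{\star s}:=X\star X^{\star(s-1)}$ for $s\ge1$. Then for every integer $s\ge0$ $$\dim\bigl(X_r^{\star s}\bigr)\le\min\bigl\{\,s\dim X_r-(s-1)\dim X_1,\ \dim\mathbb{P}(\mathrm{Mat}_{m,n})\bigr\}.$$ -/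

import Mathlib

/-- The projective space of lines in `ι → K`, with homogeneous coordinates indexed by `ι`.
It is a separate type so that it carries the Zariski topology below and no other one. -/
def ProjSpace (K : Type*) [Field K] (ι : Type*) : Type _ :=
  Projectivization K (ι → K)

namespace ProjSpace

/-- The point `[v]` with homogeneous coordinates `v ≠ 0`. -/
def mk {K : Type*} [Field K] {ι : Type*} (v : ι → K) (hv : v ≠ 0) : ProjSpace K ι :=
  Projectivization.mk K v hv

/-- Some vector of homogeneous coordinates of a point. -/
noncomputable def coords {K : Type*} [Field K] {ι : Type*} (p : ProjSpace K ι) : ι → K :=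
  Projectivization.rep p

/-- The common zeros in projective space of a set of polynomials; it is used only for sets of
homogeneous polynomials, for which it does not depend on the choice of coordinates
(see `mk_mem_zeroLocus`). -/
def zeroLocus {K : Type*} [Field K] {ι : Type*} (S : Set (MvPolynomial ι K)) :
    Set (ProjSpace K ι) :=
  {p | ∀ f ∈ S, MvPolynomial.eval p.coords f = 0}

theorem mk_mem_zeroLocus {K : Type*} [Field K] {ι : Type*} {S : Set (MvPolynomial ι K)}
    (hS : ∀ f ∈ S, ∃ d : ℕ, f.IsHomogeneous d) (v : ι → K) (hv : v ≠ 0) :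
    mk v hv ∈ zeroLocus S ↔ ∀ f ∈ S, MvPolynomial.eval v f = 0 := by
  obtain ⟨a, ha⟩ := Projectivization.exists_smul_eq_mk_rep K v hv
  refine forall₂_congr fun f hf => ?_
  obtain ⟨d, hd⟩ := hS f hf
  have hc : (mk v hv).coords = (a : K) • v := ha.symm
  have he : MvPolynomial.eval ((a : K) • v) f = (a : K) ^ d * MvPolynomial.eval v f := by
    rw [MvPolynomial.eval_eq, MvPolynomial.eval_eq, Finset.mul_sum]
    refine Finset.sum_congr rfl fun e he => ?_
    have h1 : ∑ i ∈ e.support, e i = d := by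
      have := hd (MvPolynomial.mem_support_iff.mp he)
      rwa [Finsupp.weight_apply, Finsupp.sum, Finset.sum_congr rfl (g := fun i => e i)
        (fun i _ => by simp)] at this
    simp only [Pi.smul_apply, smul_eq_mul, mul_pow, Finset.prod_mul_distrib,
      Finset.prod_pow_eq_pow_sum, h1]
    ring
  rw [hc, he]
  simp [pow_ne_zero d a.ne_zero]

/-- A set is an algebraic subset of projective space if it is the set of common zeros of
some set of homogeneous polynomials. -/
def IsAlgebraicSet {K : Type*} [Field K] {ι : Type*} (Z : Set (ProjSpace K ι)) : Prop :=
  ∃ S : Set (MvPolynomial ι K), (∀ f ∈ S, ∃ d : ℕ, f.IsHomogeneous d) ∧ Z = zeroLocus S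

theorem isAlgebraicSet_empty {K : Type*} [Field K] {ι : Type*} :
    IsAlgebraicSet (∅ : Set (ProjSpace K ι)) := by
  refine ⟨{1}, ?_, ?_⟩
  · rintro f rfl
    exact ⟨0, MvPolynomial.isHomogeneous_one ι K⟩
  · ext p
    simp [zeroLocus]

theorem isAlgebraicSet_sInter {K : Type*} [Field K] {ι : Type*}
    (A : Set (Set (ProjSpace K ι))) (hA : ∀ Z ∈ A, IsAlgebraicSet Z) :
    IsAlgebraicSet (⋂₀ A) := by
  choose! S hS hZ using hA
  refine ⟨⋃ Z ∈ A, S Z, ?_, ?_⟩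
  · intro f hf
    simp only [Set.mem_iUnion, exists_prop] at hf
    obtain ⟨Z, hZA, hf⟩ := hf
    exact hS Z hZA f hf
  · ext p
    simp only [Set.mem_sInter, zeroLocus, Set.mem_iUnion, exists_prop, Set.mem_ofPred_eq]
    constructor
    · rintro h f ⟨Z, hZA, hf⟩
      have := h Z hZA
      rw [hZ Z hZA] at this
      exact this f hf
    · intro h Z hZA
      rw [hZ Z hZA]
      exact fun f hf => h f ⟨Z, hZA, hf⟩

theorem isAlgebraicSet_union {K : Type*} [Field K] {ι : Type*}
    {Y Z : Set (ProjSpace K ι)} (hY : IsAlgebraicSet Y) (hZ : IsAlgebraicSet Z) :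
    IsAlgebraicSet (Y ∪ Z) := by
  obtain ⟨S, hS, rfl⟩ := hY
  obtain ⟨T, hT, rfl⟩ := hZ
  refine ⟨{h | ∃ f ∈ S, ∃ g ∈ T, h = f * g}, ?_, ?_⟩
  · rintro h ⟨f, hf, g, hg, rfl⟩
    obtain ⟨d, hd⟩ := hS f hf
    obtain ⟨e, he⟩ := hT g hg
    exact ⟨d + e, hd.mul he⟩
  · ext p
    simp only [zeroLocus, Set.mem_union, Set.mem_ofPred_eq]
    constructor
    · rintro (h | h) _ ⟨f, hf, g, hg, rfl⟩
      · simp [h f hf]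
      · simp [h g hg]
    · intro h
      by_contra! hc
      obtain ⟨⟨f, hf, hf0⟩, ⟨g, hg, hg0⟩⟩ := hc
      have := h (f * g) ⟨f, hf, g, hg, rfl⟩
      rw [map_mul] at this
      exact (mul_ne_zero hf0 hg0) this

/-- The Zariski topology on projective space: the closed sets are the algebraic sets. -/
instance zariskiTopology (K : Type*) [Field K] (ι : Type*) : TopologicalSpace (ProjSpace K ι) :=
  TopologicalSpace.ofClosed {Z | IsAlgebraicSet Z} isAlgebraicSet_empty
    (fun A hA => isAlgebraicSet_sInter A (fun _ hZ => hA hZ))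
    (fun _ hY _ hZ => isAlgebraicSet_union hY hZ)

theorem isClosed_iff {K : Type*} [Field K] {ι : Type*} (Z : Set (ProjSpace K ι)) :
    IsClosed Z ↔ IsAlgebraicSet Z := by
  rw [← isOpen_compl_iff]
  change Zᶜᶜ ∈ {Z | IsAlgebraicSet Z} ↔ _
  rw [compl_compl, Set.mem_ofPred_eq]

/-- The Hadamard product of two subsets of projective space: the Zariski closure of the set of
all defined products `[a] ⋆ [b] = [a * b]`, where `a * b` is the entrywise product and
`[a] ⋆ [b]` is defined when `a * b ≠ 0`. -/
def hadamard {K : Type*} [Field K] {ι : Type*} (X Y : Set (ProjSpace K ι)) :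
    Set (ProjSpace K ι) :=
  closure {p | ∃ (a b : ι → K) (ha : a ≠ 0) (hb : b ≠ 0) (hab : a * b ≠ 0),
    mk a ha ∈ X ∧ mk b hb ∈ Y ∧ p = mk (a * b) hab}

/-- The Hadamard powers: the zeroth power is the point `[1 : ⋯ : 1]` (as a set), and the power
of exponent `s + 1` is the Hadamard product of `X` and the power of exponent `s`. -/
def hadamardPow {K : Type*} [Field K] {ι : Type*} (X : Set (ProjSpace K ι)) :
    ℕ → Set (ProjSpace K ι)
  | 0 => {p | ∃ h : (1 : ι → K) ≠ 0, p = mk 1 h}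
  | s + 1 => hadamard X (hadamardPow X s)

/-- The locus of the matrices of rank at most `r` in the projective space of `m × n` matrices,
whose homogeneous coordinates are the entries. -/
def rankLocus (K : Type*) [Field K] (m n r : ℕ) : Set (ProjSpace K (Fin m × Fin n)) :=
  {p | ∃ (A : Matrix (Fin m) (Fin n) K) (hA : (fun ij : Fin m × Fin n => A ij.1 ij.2) ≠ 0),
    A.rank ≤ r ∧ p = mk (fun ij : Fin m × Fin n => A ij.1 ij.2) hA}

end ProjSpace

/-! Entrywise multiplication by a rank one matrix preserves rank at most `r`. A general matrix of
rank at most `r` is a rank one matrix times a matrix with ones in a chosen row and column;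
subtracting the all-ones matrix from the latter leaves an `(m-1) × (n-1)` block of rank at most `r -
1` (`mem_image2_bordered`). In a product of `s + 1` matrices the rank one factors can be moved into
the first matrix (`iteratedProduct_subset_zariskiHull`), so each further factor costs only
`(r-1)(m+n-r-1) = dim X_r - dim X_1` parameters. Hence the dimension is at most `dim X_r + s (dim
X_r - dim X_1)`.

To turn parameter counts into Krull dimensions, an irreducible closed set is measured by the
transcendence degree of the coordinate ring of its cone. This is strictly monotone, and it is
bounded by the number of parameters of any polynomial map covering a dense part of an ambient cone
(`topologicalKrullDim_le_of_parametrized`).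

The same count bounds `dim X_1` from above. The comparison also needs a lower bound for `dim X_r`,
which comes from an explicit chain of irreducible sets (`le_topologicalKrullDim_of_chain`,
`le_topologicalKrullDim_rankLocus`). -/

open MvPolynomial Cardinal

universe u

/-! ### Transcendence degree and homogeneous components. -/

/-- A surjection of domains over a field that is not injective lowers a finite transcendence
degree. -/
theorem trdeg_lt_of_surjective_of_not_injective {K : Type*} [Field K] {B C : Type u}
    [CommRing B] [IsDomain B] [Algebra K B] [CommRing C] [IsDomain C] [Algebra K C]
    (f : B →ₐ[K] C) (hf : Function.Surjective f) {b : B} (hb : b ≠ 0) (hfb : f b = 0)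
    (hfin : Algebra.trdeg K B < ℵ₀) :
    Algebra.trdeg K C < Algebra.trdeg K B := by
  refine lt_of_le_of_ne (trdeg_le_of_surjective f hf) fun heq => ?_
  obtain ⟨ι, x, hx⟩ := exists_isTranscendenceBasis' K C
  choose y hy using fun i => hf (x i)
  have hxy : f ∘ y = x := funext hy
  have hyi : AlgebraicIndependent K y :=
    AlgebraicIndependent.of_comp f (by rw [hxy]; exact hx.1)
  have hyb : IsTranscendenceBasis K y := by
    refine hyi.isTranscendenceBasis_of_trdeg_le hfin ?_
    rw [hx.cardinalMk_eq_trdeg, heq]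
  have halg := hyb.isAlgebraic
  -- Some nonzero polynomial in the lifts `y` is a multiple of `b`; its image under `f` is then an
  -- algebraic relation among the `x`.
  obtain ⟨r, hr0, c, hc⟩ :=
    (halg.isAlgebraic b).exists_nonzero_dvd (mem_nonZeroDivisors_of_ne_zero hb)
  obtain ⟨p, hp⟩ : ∃ p : MvPolynomial ι K, aeval y p = (r : B) := by
    exact (AlgHom.mem_range _).mp ((Algebra.adjoin_range_eq_range_aeval K y).le r.2)
  have hfr : aeval x p = 0 := by
    have h1 : f (aeval y p) = aeval x p := by
      rw [← hxy]
      exact comp_aeval_apply y f p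
    rw [← h1, hp]
    have h2 : (r : B) = b * c := hc
    rw [h2, map_mul, hfb, zero_mul]
  have hp0 : p = 0 := hx.1.eq_zero_of_aeval_eq_zero p hfr
  apply hr0
  apply Subtype.ext
  rw [← hp, hp0, map_zero]
  rfl

theorem eval_smul_of_isHomogeneous {K ι : Type*} [Field K] {f : MvPolynomial ι K} {d : ℕ}
    (hd : f.IsHomogeneous d) (a : K) (v : ι → K) : eval (a • v) f = a ^ d * eval v f := by
  rw [eval_eq, eval_eq, Finset.mul_sum]
  refine Finset.sum_congr rfl fun e he => ?_
  have h1 : ∑ i ∈ e.support, e i = d := by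
    have := hd (mem_support_iff.mp he)
    rwa [Finsupp.weight_apply, Finsupp.sum, Finset.sum_congr rfl (g := fun i => e i)
      (fun i _ => by simp)] at this
  simp only [Pi.smul_apply, smul_eq_mul, mul_pow, Finset.prod_mul_distrib,
    Finset.prod_pow_eq_pow_sum, h1]
  ring

/-- A polynomial that vanishes on the line through `v` has homogeneous components vanishing
at `v`. -/
theorem eval_homogeneousComponent_eq_zero {K ι : Type*} [Field K] [Infinite K]
    {f : MvPolynomial ι K} {v : ι → K} (h : ∀ a : K, eval (a • v) f = 0) (d : ℕ) :
    eval v (homogeneousComponent d f) = 0 := by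
  -- `q` is the univariate polynomial `a ↦ f (a • v)`.
  let q : Polynomial K := ∑ i ∈ Finset.range (f.totalDegree + 1),
    Polynomial.monomial i (eval v (homogeneousComponent i f))
  have hq : q = 0 := by
    refine Polynomial.funext fun a => ?_
    have h1 := h a
    rw [← sum_homogeneousComponent f, map_sum] at h1
    simp only [q, Polynomial.eval_finsetSum, Polynomial.eval_monomial, Polynomial.eval_zero]
    rw [← h1]
    refine Finset.sum_congr rfl fun i _ => ?_
    rw [eval_smul_of_isHomogeneous (homogeneousComponent_isHomogeneous i f), mul_comm]
  by_cases hd : f.totalDegree < d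
  · rw [homogeneousComponent_eq_zero d f hd, map_zero]
  · have h2 := congrArg (fun p => p.coeff d) hq
    simp only [q, Polynomial.finsetSum_coeff, Polynomial.coeff_monomial, Polynomial.coeff_zero,
      Finset.sum_ite_eq', Finset.mem_range] at h2
    rwa [if_pos (by omega)] at h2

/-! ### Zariski closure in affine space. -/

/-- The closure of a set in affine space for the Zariski topology. -/
def zariskiHull {K ι : Type*} [Field K] (S : Set (ι → K)) : Set (ι → K) :=
  {v | ∀ f : MvPolynomial ι K, (∀ w ∈ S, eval w f = 0) → eval v f = 0}

section Hull

variable {K ι κ : Type*} [Field K]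

theorem subset_zariskiHull (S : Set (ι → K)) : S ⊆ zariskiHull S := fun v hv _ hf => hf v hv

theorem zariskiHull_subset {S T : Set (ι → K)} (h : S ⊆ zariskiHull T) :
    zariskiHull S ⊆ zariskiHull T :=
  fun _ hv f hf => hv f fun _ hw => h hw f hf

theorem zariskiHull_mono {S T : Set (ι → K)} (h : S ⊆ T) : zariskiHull S ⊆ zariskiHull T :=
  zariskiHull_subset (h.trans (subset_zariskiHull T))

theorem eval_bind₁_eq (φ : κ → MvPolynomial ι K) (f : MvPolynomial κ K) (v : ι → K) :
    eval v (bind₁ φ f) = eval (fun k => eval v (φ k)) f := by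
  simpa [coe_aeval_eq_eval] using aeval_bind₁ v φ f

/-- Polynomial maps are continuous for the Zariski topology. -/
theorem eval_mem_zariskiHull {S : Set (ι → K)} {T : Set (κ → K)} (φ : κ → MvPolynomial ι K)
    (h : ∀ w ∈ S, (fun k => eval w (φ k)) ∈ zariskiHull T) {v : ι → K} (hv : v ∈ zariskiHull S) :
    (fun k => eval v (φ k)) ∈ zariskiHull T := by
  intro f hf
  rw [← eval_bind₁_eq]
  refine hv _ fun w hw => ?_
  rw [eval_bind₁_eq]
  exact h w hw f hf

theorem mul_left_mem_zariskiHull {S T : Set (ι → K)} (a : ι → K)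
    (h : ∀ w ∈ S, a * w ∈ zariskiHull T) {v : ι → K} (hv : v ∈ zariskiHull S) :
    a * v ∈ zariskiHull T := by
  have := eval_mem_zariskiHull (T := T) (fun k => C (a k) * X k) (S := S)
    (fun w hw => by simpa using! h w hw) hv
  simpa using! this

/-- Multiplication is continuous in each factor separately, so one factor is kept fixed while the
other passes to the closure. -/
theorem mul_mem_zariskiHull_mul {S T : Set (ι → K)} {v w : ι → K} (hv : v ∈ zariskiHull S)
    (hw : w ∈ zariskiHull T) : v * w ∈ zariskiHull (Set.image2 (· * ·) S T) := by
  refine mul_left_mem_zariskiHull v (fun b hb => ?_) hw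
  rw [mul_comm]
  refine mul_left_mem_zariskiHull b (fun a ha => ?_) hv
  rw [mul_comm]
  exact subset_zariskiHull _ ⟨a, ha, b, hb, rfl⟩

/-- To see that the values of a polynomial map lie in a Zariski closed set it suffices to
look at a nonempty principal open set. -/
theorem eval_mem_zariskiHull_of_dense [Infinite K] {T : Set (κ → K)} (φ : κ → MvPolynomial ι K)
    {g : MvPolynomial ι K} (hg : g ≠ 0)
    (h : ∀ v, eval v g ≠ 0 → (fun k => eval v (φ k)) ∈ zariskiHull T) (v : ι → K) :
    (fun k => eval v (φ k)) ∈ zariskiHull T := by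
  intro f hf
  have h0 : bind₁ φ f * g = 0 := by
    refine funext fun w => ?_
    rw [map_mul, map_zero, eval_bind₁_eq]
    by_cases hw : eval w g = 0
    · rw [hw, mul_zero]
    · rw [h w hw f hf, zero_mul]
  rw [← eval_bind₁_eq, (mul_eq_zero.mp h0).resolve_right hg, map_zero]

/-- A set of vectors closed under scaling. -/
def IsScalingClosed (S : Set (ι → K)) : Prop := ∀ (a : K), ∀ v ∈ S, a • v ∈ S

theorem IsScalingClosed.zariskiHull {S : Set (ι → K)} (hS : IsScalingClosed S) :
    IsScalingClosed (zariskiHull S) := by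
  intro a v hv
  have := mul_left_mem_zariskiHull (T := S) (fun _ => a)
    (fun w hw => subset_zariskiHull S (hS a w hw)) hv
  exact this

end Hull

/-! ### Projective sets, their cones and the ideals of the cones. -/

namespace ProjSpace

section Cone

variable {K ι : Type*} [Field K]

theorem coords_ne_zero (p : ProjSpace K ι) : p.coords ≠ 0 := Projectivization.rep_nonzero p

theorem mk_coords (p : ProjSpace K ι) : mk p.coords p.coords_ne_zero = p :=
  Projectivization.mk_rep p

theorem exists_coords_mk (v : ι → K) (hv : v ≠ 0) :
    ∃ a : K, a ≠ 0 ∧ (mk v hv).coords = a • v ∧ v = a⁻¹ • (mk v hv).coords := by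
  obtain ⟨a, ha⟩ := Projectivization.exists_smul_eq_mk_rep K v hv
  have h : (mk v hv).coords = (a : K) • v := ha.symm
  refine ⟨a, a.ne_zero, h, ?_⟩
  rw [h, smul_smul, inv_mul_cancel₀ a.ne_zero, one_smul]

theorem mk_smul (v : ι → K) (hv : v ≠ 0) {a : K} (ha : a ≠ 0) :
    mk (a • v) (smul_ne_zero ha hv) = mk v hv :=
  (Projectivization.mk_eq_mk_iff' K _ _ _ _).mpr ⟨a, rfl⟩

/-- The projective variety of a cone. -/
def projHull (S : Set (ι → K)) : Set (ProjSpace K ι) := {p | p.coords ∈ zariskiHull S}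

theorem mk_mem_projHull {S : Set (ι → K)} (hS : IsScalingClosed S) (v : ι → K) (hv : v ≠ 0) :
    mk v hv ∈ projHull S ↔ v ∈ zariskiHull S := by
  obtain ⟨a, -, h1, h2⟩ := exists_coords_mk v hv
  constructor
  · intro h
    rw [h2]
    exact hS.zariskiHull _ _ h
  · intro h
    change (mk v hv).coords ∈ zariskiHull S
    rw [h1]
    exact hS.zariskiHull _ _ h

theorem isClosed_projHull [Infinite K] {S : Set (ι → K)} (hS : IsScalingClosed S) :
    IsClosed (projHull S) := by
  rw [isClosed_iff]
  refine ⟨{f | (∃ d : ℕ, f.IsHomogeneous d) ∧ ∀ w ∈ S, eval w f = 0}, fun f hf => hf.1, ?_⟩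
  ext p
  constructor
  · intro hp f hf
    exact hp f hf.2
  · intro hp f (hf : ∀ w ∈ S, eval w f = 0)
    rw [← sum_homogeneousComponent f, map_sum]
    refine Finset.sum_eq_zero fun d _ => ?_
    have hfd : ∀ w ∈ S, eval w (homogeneousComponent d f) = 0 := fun w hw =>
      eval_homogeneousComponent_eq_zero (fun a => hf (a • w) (hS a w hw)) d
    exact hp _ ⟨⟨d, homogeneousComponent_isHomogeneous d f⟩, hfd⟩

/-- The affine cone over a set of points in projective space. -/
def cone (Z : Set (ProjSpace K ι)) : Set (ι → K) := {v | ∀ hv : v ≠ 0, mk v hv ∈ Z}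

theorem isScalingClosed_cone (Z : Set (ProjSpace K ι)) : IsScalingClosed (cone Z) := by
  intro a v hv hav
  have ha : a ≠ 0 := fun h => hav (by rw [h, zero_smul])
  have hv0 : v ≠ 0 := fun h => hav (by rw [h, smul_zero])
  rw [mk_smul v hv0 ha]
  exact hv hv0

theorem zero_mem_cone (Z : Set (ProjSpace K ι)) : (0 : ι → K) ∈ cone Z := fun h => absurd rfl h

/-- The ideal of the affine cone over a set of points in projective space. -/
def coneIdeal (Z : Set (ProjSpace K ι)) : Ideal (MvPolynomial ι K) where
  carrier := {f | ∀ v ∈ cone Z, eval v f = 0}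
  add_mem' hf hg v hv := by rw [map_add, hf v hv, hg v hv, add_zero]
  zero_mem' _ _ := map_zero _
  smul_mem' c f hf v hv := by rw [smul_eq_mul, map_mul, hf v hv, mul_zero]

theorem mem_coneIdeal {Z : Set (ProjSpace K ι)} {f : MvPolynomial ι K} :
    f ∈ coneIdeal Z ↔ ∀ v ∈ cone Z, eval v f = 0 := Iff.rfl

theorem coords_mem_cone {Z : Set (ProjSpace K ι)} {p : ProjSpace K ι} (hp : p ∈ Z) :
    p.coords ∈ cone Z := fun _ => by rwa [mk_coords]

theorem mem_coneIdeal_of_isHomogeneous {Z : Set (ProjSpace K ι)} (hZ : Z.Nonempty)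
    {f : MvPolynomial ι K} {d : ℕ} (hd : f.IsHomogeneous d) :
    f ∈ coneIdeal Z ↔ Z ⊆ zeroLocus {f} := by
  constructor
  · rintro h p hp _ rfl
    exact h _ (coords_mem_cone hp)
  · intro h v hv
    by_cases hv0 : v = 0
    · obtain ⟨p, hp⟩ := hZ
      rw [hv0, ← zero_smul K p.coords, eval_smul_of_isHomogeneous hd, h hp f rfl, mul_zero]
    · refine (mk_mem_zeroLocus ?_ v hv0).mp (h (hv hv0)) f rfl
      rintro _ rfl
      exact ⟨d, hd⟩

/-- The ideal is homogeneous because the field is infinite, so primality may be tested on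
homogeneous elements. For these, membership means that a hypersurface contains `Z`, and
irreducibility of `Z` applies. -/
theorem coneIdeal_isPrime [Infinite K] {Z : Set (ProjSpace K ι)} (hZ : IsIrreducible Z) :
    (coneIdeal Z).IsPrime := by
  let _ : GradedAlgebra (homogeneousSubmodule ι K) := MvPolynomial.gradedAlgebra
  have hom : (coneIdeal Z).IsHomogeneous (homogeneousSubmodule ι K) := by
    intro i f hf
    change ((decomposition.decompose' f i : homogeneousSubmodule ι K i) : MvPolynomial ι K) ∈ _
    rw [decomposition.decompose'_apply]
    exact fun v hv => eval_homogeneousComponent_eq_zero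
      (fun a => hf _ (isScalingClosed_cone Z a v hv)) i
  refine hom.isPrime_of_homogeneous_mem_or_mem ?_ ?_
  · intro h
    have h1 := mem_coneIdeal.mp ((Ideal.eq_top_iff_one _).mp h) 0 (zero_mem_cone Z)
    simp at h1
  · rintro f g ⟨d, hd⟩ ⟨e, he⟩ hfg
    rw [mem_homogeneousSubmodule] at hd he
    rw [mem_coneIdeal_of_isHomogeneous hZ.1 hd, mem_coneIdeal_of_isHomogeneous hZ.1 he]
    refine isPreirreducible_iff_isClosed_union_isClosed.mp hZ.2 _ _
      ((isClosed_iff _).mpr ⟨{f}, by rintro _ rfl; exact ⟨d, hd⟩, rfl⟩)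
      ((isClosed_iff _).mpr ⟨{g}, by rintro _ rfl; exact ⟨e, he⟩, rfl⟩) fun p hp => ?_
    have h1 := hfg _ (coords_mem_cone hp)
    rw [map_mul, mul_eq_zero] at h1
    refine h1.imp ?_ ?_ <;> rintro h _ rfl <;> exact h

theorem coneIdeal_antitone {Z W : Set (ProjSpace K ι)} (h : Z ⊆ W) :
    coneIdeal W ≤ coneIdeal Z := fun _ hf v hv => hf v fun hv0 => h (hv hv0)

theorem subset_of_coneIdeal_le {Z W : Set (ProjSpace K ι)} (hZ : IsClosed Z) (hne : Z.Nonempty)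
    (h : coneIdeal Z ≤ coneIdeal W) : W ⊆ Z := by
  obtain ⟨S, hS, rfl⟩ := (isClosed_iff Z).mp hZ
  intro p hp f hf
  obtain ⟨d, hd⟩ := hS f hf
  refine h ((mem_coneIdeal_of_isHomogeneous hne hd).mpr ?_) _ (coords_mem_cone hp)
  rintro q hq _ rfl
  exact hq _ hf

/-- A relation among the parametrizing polynomials vanishes on `S`, hence on its closure. -/
theorem ker_aeval_le_coneIdeal {τ : Type*} {S : Set (ι → K)} (hS : IsScalingClosed S)
    (φ : ι → MvPolynomial τ K) (hφ : ∀ v ∈ S, ∃ t, v = fun i => eval t (φ i))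
    {Z : Set (ProjSpace K ι)} (hne : Z.Nonempty) (hZ : Z ⊆ projHull S) :
    RingHom.ker (aeval φ : MvPolynomial ι K →ₐ[K] MvPolynomial τ K) ≤ coneIdeal Z := by
  intro f hf v hv
  have hv' : v ∈ zariskiHull S := by
    by_cases hv0 : v = 0
    · obtain ⟨p, hp⟩ := hne
      rw [hv0, ← zero_smul K p.coords]
      exact hS.zariskiHull _ _ (hZ hp)
    · exact (mk_mem_projHull hS v hv0).mp (hZ (hv hv0))
  refine hv' f fun w hw => ?_
  obtain ⟨t, rfl⟩ := hφ w hw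
  rw [← eval_bind₁_eq]
  have : bind₁ φ f = 0 := hf
  rw [this, map_zero]

end Cone

/-! ### Krull dimension bounded by the number of parameters. -/

section Dimension

variable {K ι τ : Type u} [Field K] [Infinite K]

/-- The dimension of the affine cone over an irreducible closed set. -/
noncomputable def coneDim (Z : Set (ProjSpace K ι)) : ℕ :=
  Cardinal.toNat (Algebra.trdeg K (MvPolynomial ι K ⧸ coneIdeal Z))

theorem trdeg_quotient_coneIdeal_lt [Finite ι] {Z : Set (ProjSpace K ι)} (hZ : IsIrreducible Z) :
    Algebra.trdeg K (MvPolynomial ι K ⧸ coneIdeal Z) < ℵ₀ := by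
  have := coneIdeal_isPrime hZ
  exact trdeg_lt_aleph0_of_finiteType

/-- A closed set is determined by its ideal, so the surjection between the coordinate rings of the
cones has a nonzero kernel. -/
theorem coneDim_strictMono [Finite ι] {Z W : Set (ProjSpace K ι)} (hZ : IsIrreducible Z)
    (hW : IsIrreducible W) (hZc : IsClosed Z) (h : Z ⊂ W) : coneDim Z < coneDim W := by
  have hZp := coneIdeal_isPrime hZ
  have hWp := coneIdeal_isPrime hW
  obtain ⟨f, hfZ, hfW⟩ : ∃ f ∈ coneIdeal Z, f ∉ coneIdeal W := by
    by_contra! hc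
    exact h.2 (subset_of_coneIdeal_le hZc hZ.1 hc)
  have h1 := trdeg_lt_of_surjective_of_not_injective
    (Ideal.Quotient.factorₐ K (coneIdeal_antitone h.1))
    (Ideal.Quotient.factor_surjective (coneIdeal_antitone h.1))
    (b := Ideal.Quotient.mk _ f) (by rwa [Ne, Ideal.Quotient.eq_zero_iff_mem])
    ((Ideal.Quotient.eq_zero_iff_mem).mpr hfZ) (trdeg_quotient_coneIdeal_lt hW)
  exact Cardinal.toNat_lt_toNat h1 (trdeg_quotient_coneIdeal_lt hW)

/-- The vertex is a proper closed subset of the cone: evaluation at the origin kills a coordinate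
that is not identically zero on the cone. -/
theorem coneDim_pos [Finite ι] {Z : Set (ProjSpace K ι)} (hZ : IsIrreducible Z) :
    0 < coneDim Z := by
  have hZp := coneIdeal_isPrime hZ
  obtain ⟨p, hp⟩ := hZ.1
  obtain ⟨i, hi⟩ := Function.ne_iff.mp p.coords_ne_zero
  have hk : ∀ f ∈ coneIdeal Z, aeval (0 : ι → K) f = 0 := fun f hf => hf 0 (zero_mem_cone Z)
  have h1 := trdeg_lt_of_surjective_of_not_injective (Ideal.Quotient.liftₐ _ _ hk)
    (fun a => ⟨algebraMap K _ a, AlgHom.commutes _ a⟩) (b := Ideal.Quotient.mk _ (X i))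
    (by
      rw [Ne, Ideal.Quotient.eq_zero_iff_mem]
      intro h
      exact hi (by simpa using h _ (coords_mem_cone hp)))
    (by
      change aeval (0 : ι → K) (X i) = 0
      simp) (trdeg_quotient_coneIdeal_lt hZ)
  exact pos_of_gt (Cardinal.toNat_lt_toNat h1 (trdeg_quotient_coneIdeal_lt hZ))

/-- The coordinate ring of the cone is a quotient of the image of `aeval φ`, which is a subring of a
polynomial ring in the parameters. -/
theorem coneDim_le_card [Finite ι] [Fintype τ] {S : Set (ι → K)} (hS : IsScalingClosed S)
    (φ : ι → MvPolynomial τ K) (hφ : ∀ v ∈ S, ∃ t, v = fun i => eval t (φ i))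
    {Z : Set (ProjSpace K ι)} (hZ : IsIrreducible Z) (hZS : Z ⊆ projHull S) :
    coneDim Z ≤ Fintype.card τ := by
  have hZp := coneIdeal_isPrime hZ
  have hker := ker_aeval_le_coneIdeal hS φ hφ hZ.1 hZS
  have h1 := trdeg_le_of_surjective (Ideal.Quotient.factorₐ K hker)
    (Ideal.Quotient.factor_surjective hker)
  have h2 := trdeg_le_of_injective (Ideal.kerLiftAlg (aeval φ : _ →ₐ[K] MvPolynomial τ K))
    (Ideal.kerLiftAlg_injective _)
  have h3 := h1.trans h2
  rw [MvPolynomial.trdeg_of_isDomain, Cardinal.lift_id, Cardinal.mk_fintype] at h3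
  have h4 := Cardinal.toNat_le_toNat h3 (Cardinal.natCast_lt_aleph0)
  rwa [Cardinal.toNat_natCast] at h4

/-- A subset of the projective variety of a cone parametrized by `d + 1` parameters has
dimension at most `d`. -/
theorem topologicalKrullDim_le_of_parametrized [Finite ι] [Fintype τ] {S : Set (ι → K)}
    (hS : IsScalingClosed S) (φ : ι → MvPolynomial τ K)
    (hφ : ∀ v ∈ S, ∃ t, v = fun i => eval t (φ i)) {d : ℕ} (hd : Fintype.card τ ≤ d + 1)
    {X : Set (ProjSpace K ι)} (hX : X ⊆ projHull S) : topologicalKrullDim X ≤ d := by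
  let m : TopologicalSpace.IrreducibleCloseds X → TopologicalSpace.IrreducibleCloseds
    (ProjSpace K ι) := TopologicalSpace.IrreducibleCloseds.map Subtype.val continuous_subtype_val
  have hm : StrictMono m := TopologicalSpace.IrreducibleCloseds.map_strictMono_of_isInducing
    Topology.IsInducing.subtypeVal
  have hsub : ∀ Z, (m Z : Set (ProjSpace K ι)) ⊆ projHull S := fun Z => by
    refine closure_minimal ?_ (isClosed_projHull hS)
    rintro _ ⟨p, -, rfl⟩
    exact hX p.2
  -- The cone has one dimension more than the projective set. Since `coneDim` is positive, the
  -- truncated subtraction keeps strict monotonicity.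
  have hlt : ∀ Z, coneDim (m Z : Set (ProjSpace K ι)) - 1 < d + 1 := fun Z => by
    have := coneDim_le_card hS φ hφ (m Z).isIrreducible (hsub Z)
    omega
  have h1 := Order.krullDim_le_of_strictMono
    (fun Z => (⟨coneDim (m Z : Set (ProjSpace K ι)) - 1, hlt Z⟩ : Fin (d + 1))) (by
      intro Z W h
      have h2 := coneDim_strictMono (m Z).isIrreducible (m W).isIrreducible (m Z).isClosed
        (hm h)
      have h3 := coneDim_pos (m Z).isIrreducible
      rw [Fin.mk_lt_mk]
      omega)
  refine h1.trans ?_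
  refine iSup_le fun l => ?_
  have := l.length_lt_card
  rw [Fintype.card_fin] at this
  exact_mod_cast Nat.lt_succ_iff.mp this

end Dimension

end ProjSpace

/-! ### Matrices of bounded rank: dense charts and the bordered normal form. -/

section RankSet

variable {K I J : Type*} [Field K]

/-- The entries of the matrices of rank at most `r`. -/
def rankSet (K I J : Type*) [Field K] (r : ℕ) : Set (I × J → K) :=
  {v | ∃ (P : I → Fin r → K) (Q : Fin r → J → K), ∀ i j, v (i, j) = ∑ k, P i k * Q k j}

/-- The entries of the rank one matrices, and of the zero matrix. -/
def outerSet (K I J : Type*) [Field K] : Set (I × J → K) :=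
  {v | ∃ (a : I → K) (b : J → K), ∀ i j, v (i, j) = a i * b j}

theorem mul_mem_rankSet {r : ℕ} {v w : I × J → K} (hv : v ∈ rankSet K I J r)
    (hw : w ∈ outerSet K I J) : v * w ∈ rankSet K I J r := by
  obtain ⟨P, Q, h⟩ := hv
  obtain ⟨a, b, h'⟩ := hw
  refine ⟨fun i k => P i k * a i, fun k j => Q k j * b j, fun i j => ?_⟩
  rw [Pi.mul_apply, h, h', Finset.sum_mul]
  exact Finset.sum_congr rfl fun k _ => by ring

theorem const_mem_outerSet (a : K) : (fun _ => a : I × J → K) ∈ outerSet K I J :=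
  ⟨fun _ => a, fun _ => 1, fun _ _ => (mul_one a).symm⟩

theorem isScalingClosed_rankSet (r : ℕ) : IsScalingClosed (rankSet K I J r) := by
  intro a v hv
  have := mul_mem_rankSet hv (const_mem_outerSet a)
  rwa [mul_comm] at this

theorem one_mem_rankSet {r : ℕ} (hr : 1 ≤ r) : (1 : I × J → K) ∈ rankSet K I J r := by
  obtain ⟨r, rfl⟩ := Nat.exists_eq_add_of_le' hr
  refine ⟨fun _ k => if k = 0 then 1 else 0, fun _ _ => 1, fun i j => ?_⟩
  simp

/-- The entries of the matrices whose rows are combinations of the first `r` ones, where the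
order of the rows is given by `e`. -/
def graphSet (K J : Type*) {I q : Type*} [Field K] {r : ℕ} (e : I ≃ Fin r ⊕ q) :
    Set (I × J → K) :=
  {v | ∃ (M : q → Fin r → K) (N : Fin r → J → K), ∀ i j,
    v (i, j) = Sum.elim (fun k => N k j) (fun i' => ∑ k, M i' k * N k j) (e i)}

theorem isScalingClosed_graphSet {q : Type*} {r : ℕ} (e : I ≃ Fin r ⊕ q) :
    IsScalingClosed (graphSet K J e) := by
  rintro a v ⟨M, N, h⟩
  refine ⟨M, fun k j => a * N k j, fun i j => ?_⟩
  rw [Pi.smul_apply, h, smul_eq_mul]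
  rcases e i with k | i'
  · rfl
  · simp only [Sum.elim_inr, Finset.mul_sum]
    exact Finset.sum_congr rfl fun k _ => by ring

/-- The generic matrix product. -/
noncomputable def genericProduct (K I J : Type*) [Field K] (r : ℕ) (p : I × J) :
    MvPolynomial (I × Fin r ⊕ Fin r × J) K :=
  ∑ k, X (Sum.inl (p.1, k)) * X (Sum.inr (k, p.2))

theorem eval_genericProduct {r : ℕ} (t : I × Fin r ⊕ Fin r × J → K) (p : I × J) :
    eval t (genericProduct K I J r p) = ∑ k, t (Sum.inl (p.1, k)) * t (Sum.inr (k, p.2)) := by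
  simp [genericProduct]

/-- To show that a Zariski closed set contains all matrices of rank at most `r`, it suffices to
look at a nonempty open set of pairs of factors. -/
theorem rankSet_subset_zariskiHull [Infinite K] {r : ℕ} {T : Set (I × J → K)}
    {g : MvPolynomial (I × Fin r ⊕ Fin r × J) K} (hg : g ≠ 0)
    (h : ∀ t, eval t g ≠ 0 →
      (fun p : I × J => ∑ k, t (Sum.inl (p.1, k)) * t (Sum.inr (k, p.2))) ∈ zariskiHull T) :
    rankSet K I J r ⊆ zariskiHull T := by
  rintro v ⟨P, Q, hv⟩
  have := eval_mem_zariskiHull_of_dense (T := T) (genericProduct K I J r) hg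
    (fun t ht => by simpa only [eval_genericProduct] using h t ht)
    (Sum.elim (fun p => P p.1 p.2) (fun p => Q p.1 p.2))
  convert this using 1
  ext p
  rw [eval_genericProduct]
  exact hv p.1 p.2

/-- If the rows of `P` selected by `e` form an invertible matrix `A`, then `P Q = (P A⁻¹)(A Q)`,
where the selected rows of `P A⁻¹` form the identity. This saves the `r²` redundant parameters of
the factorization. -/
theorem rankSet_subset_zariskiHull_graphSet [Infinite K] {q : Type*} {r : ℕ}
    (e : I ≃ Fin r ⊕ q) : rankSet K I J r ⊆ zariskiHull (graphSet K J e) := by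
  classical
  let G : Matrix (Fin r) (Fin r) (MvPolynomial (I × Fin r ⊕ Fin r × J) K) :=
    Matrix.of fun i k => X (Sum.inl (e.symm (Sum.inl i), k))
  have heval : ∀ t, eval t G.det =
      (Matrix.of fun i k => t (Sum.inl (e.symm (Sum.inl i), k))).det := fun t => by
    rw [RingHom.map_det]
    congr 1
    ext i k
    simp [G]
  refine rankSet_subset_zariskiHull (g := G.det) (fun h0 => ?_) fun t ht => ?_
  · have h1 := heval (Sum.elim (fun p => if e p.1 = Sum.inl p.2 then 1 else 0) 0)
    have h2 : (Matrix.of fun i k : Fin r => (Sum.elim (fun p => if e p.1 = Sum.inl p.2 then 1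
        else 0) 0 : I × Fin r ⊕ Fin r × J → K) (Sum.inl (e.symm (Sum.inl i), k))) = 1 := by
      ext i k
      simp [Matrix.one_apply]
    rw [h0, h2] at h1
    simp at h1
  · rw [heval] at ht
    set A : Matrix (Fin r) (Fin r) K := Matrix.of fun i k =>
      t (Sum.inl (e.symm (Sum.inl i), k)) with hA
    have hinv : A⁻¹ * A = 1 := Matrix.nonsing_inv_mul A (isUnit_iff_ne_zero.mpr ht)
    let B : Matrix q (Fin r) K := Matrix.of fun i k => t (Sum.inl (e.symm (Sum.inr i), k))
    let Q : Matrix (Fin r) J K := Matrix.of fun k j => t (Sum.inr (k, j))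
    refine subset_zariskiHull _ ⟨B * A⁻¹, A * Q, fun i j => ?_⟩
    obtain ⟨x, rfl⟩ := e.symm.surjective i
    rw [e.apply_symm_apply]
    rcases x with k | i'
    · rfl
    · have h1 : B * A⁻¹ * (A * Q) = B * Q := by
        rw [Matrix.mul_assoc, ← Matrix.mul_assoc A⁻¹, hinv, Matrix.one_mul]
      exact (congrFun (congrFun h1 i') j).symm

/-- The matrices with all entries `1` in the row `i₀` and the column `j₀`, and with
entries `1 + w` elsewhere. -/
noncomputable def bordered {K I J : Type*} [Field K] (i₀ : I) (j₀ : J)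
    (w : {i // i ≠ i₀} × {j // j ≠ j₀} → K) (p : I × J) : K :=
  open Classical in 1 + if h : p.1 ≠ i₀ ∧ p.2 ≠ j₀ then w (⟨p.1, h.1⟩, ⟨p.2, h.2⟩) else 0

/-- Rescaling rows by `a` and columns by `b` turns row `i₀` and column `j₀` into ones. Subtracting
the all-ones matrix is then a Schur complement step, which lowers the rank bound by one. -/
theorem mem_image2_bordered {r : ℕ} (i₀ : I) (j₀ : J) {v : I × J → K}
    (hv : v ∈ rankSet K I J (r + 1)) (hi : ∀ i, v (i, j₀) ≠ 0) (hj : ∀ j, v (i₀, j) ≠ 0) :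
    v ∈ Set.image2 (· * ·) (outerSet K I J)
      (bordered i₀ j₀ '' rankSet K {i // i ≠ i₀} {j // j ≠ j₀} r) := by
  obtain ⟨P, Q, h⟩ := hv
  obtain ⟨k₀, hk₀⟩ : ∃ k, P i₀ k ≠ 0 := by
    by_contra! hc
    exact hi i₀ (by rw [h]; simp [hc])
  let a : I → K := fun i => v (i, j₀)
  let b : J → K := fun j => v (i₀, j) / v (i₀, j₀)
  have ha : ∀ i, a i ≠ 0 := hi
  have hb : ∀ j, b j ≠ 0 := fun j => div_ne_zero (hj j) (hj j₀)
  -- Row `i₀` is used to eliminate the summand `k₀`; what it leaves behind, the last term in `key`,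
  -- does not depend on `j` and cancels on comparison with column `j₀`.
  let R : I → Fin r → K := fun i k =>
    (P i (k₀.succAbove k) - P i k₀ * P i₀ (k₀.succAbove k) / P i₀ k₀) / a i
  let w : I × J → K := fun p => ∑ k, R p.1 k *
    (Q (k₀.succAbove k) p.2 / b p.2 - Q (k₀.succAbove k) j₀)
  have hb0 : b j₀ = 1 := div_self (hj j₀)
  have key : ∀ i j, v (i, j) / (a i * b j) = ∑ k, R i k * (Q (k₀.succAbove k) j / b j) +
      P i k₀ * v (i₀, j₀) / (P i₀ k₀ * a i) := fun i j => by
    have h1 := h i j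
    have h2 := h i₀ j
    rw [Fin.sum_univ_succAbove _ k₀] at h1 h2
    have h3 : ∑ k, R i k * (Q (k₀.succAbove k) j / b j) =
        (∑ k, P i (k₀.succAbove k) * Q (k₀.succAbove k) j - P i k₀ / P i₀ k₀ *
          ∑ k, P i₀ (k₀.succAbove k) * Q (k₀.succAbove k) j) / (a i * b j) := by
      rw [Finset.mul_sum, ← Finset.sum_sub_distrib, Finset.sum_div]
      refine Finset.sum_congr rfl fun k _ => ?_
      have := ha i
      have := hb j
      simp only [R]
      field_simp
    have h4 : v (i₀, j) = b j * v (i₀, j₀) := (div_mul_cancel₀ _ (hj j₀)).symm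
    rw [h3, eq_sub_of_add_eq' h1.symm, eq_sub_of_add_eq' h2.symm, h4]
    have := ha i
    have := hb j
    field_simp
    ring
  have hw : ∀ i j, v (i, j) / (a i * b j) = 1 + w (i, j) := fun i j => by
    have h1 := key i j
    have h2 := key i j₀
    rw [hb0, mul_one, show v (i, j₀) / a i = 1 from div_self (hi i)] at h2
    simp only [div_one] at h2
    have h3 : w (i, j) = ∑ k, R i k * (Q (k₀.succAbove k) j / b j) -
        ∑ k, R i k * Q (k₀.succAbove k) j₀ := by
      rw [← Finset.sum_sub_distrib]
      exact Finset.sum_congr rfl fun k _ => mul_sub _ _ _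
    rw [h1, h3, h2]
    ring
  refine ⟨fun p => a p.1 * b p.2, ⟨a, b, fun _ _ => rfl⟩, _, ⟨fun p => w (p.1, p.2),
    ⟨fun i => R i, fun k j => Q (k₀.succAbove k) j / b j - Q (k₀.succAbove k) j₀,
      fun _ _ => rfl⟩, rfl⟩, ?_⟩
  ext ⟨i, j⟩
  have hab : a i * b j ≠ 0 := mul_ne_zero (ha i) (hb j)
  by_cases hij : i ≠ i₀ ∧ j ≠ j₀
  · simp only [Pi.mul_apply, bordered, dif_pos hij]
    rw [← hw i j, mul_div_cancel₀ _ hab]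
  · simp only [Pi.mul_apply, bordered, dif_neg hij, add_zero, mul_one]
    rw [not_and_or, not_not, not_not] at hij
    rcases hij with rfl | rfl
    · exact mul_div_cancel₀ _ (hj j₀)
    · rw [hb0, mul_one]

theorem rankSet_succ_subset_zariskiHull [Infinite K] [Finite I] [Finite J] {r : ℕ} (i₀ : I)
    (j₀ : J) : rankSet K I J (r + 1) ⊆ zariskiHull (Set.image2 (· * ·) (outerSet K I J)
      (bordered i₀ j₀ '' rankSet K {i // i ≠ i₀} {j // j ≠ j₀} r)) := by
  cases nonempty_fintype I
  cases nonempty_fintype J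
  refine rankSet_subset_zariskiHull (g := (∏ i, genericProduct K I J (r + 1) (i, j₀)) *
    ∏ j, genericProduct K I J (r + 1) (i₀, j)) (fun h0 => ?_) fun t ht => ?_
  -- At this point the generic product is the all-ones matrix.
  · have h1 := congrArg (eval (Sum.elim (fun p => if p.2 = 0 then 1 else 0) 1)) h0
    simp [eval_genericProduct] at h1
  · rw [map_mul, map_prod, map_prod] at ht
    obtain ⟨h1, h2⟩ := mul_ne_zero_iff.mp ht
    rw [Finset.prod_ne_zero_iff] at h1 h2
    simp only [eval_genericProduct] at h1 h2
    exact subset_zariskiHull _ (mem_image2_bordered i₀ j₀ ⟨fun i k => t (Sum.inl (i, k)),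
      fun k j => t (Sum.inr (k, j)), fun _ _ => rfl⟩ (fun i => h1 i (Finset.mem_univ i))
      fun j => h2 j (Finset.mem_univ j))

theorem bordered_mem_zariskiHull {i₀ : I} {j₀ : J}
    {T : Set ({i // i ≠ i₀} × {j // j ≠ j₀} → K)} {w : {i // i ≠ i₀} × {j // j ≠ j₀} → K}
    (hw : w ∈ zariskiHull T) :
    bordered i₀ j₀ w ∈ zariskiHull (bordered i₀ j₀ '' T) := by
  classical
  have key : ∀ u, (fun p => eval u ((1 : MvPolynomial ({i // i ≠ i₀} × {j // j ≠ j₀}) K) +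
      if h : p.1 ≠ i₀ ∧ p.2 ≠ j₀ then X (⟨p.1, h.1⟩, ⟨p.2, h.2⟩) else 0)) = bordered i₀ j₀ u := by
    intro u
    ext p
    simp only [bordered, map_add, map_one]
    split_ifs <;> simp
  rw [← key]
  refine eval_mem_zariskiHull _ (fun u hu => ?_) hw
  rw [key]
  exact subset_zariskiHull _ ⟨u, hu, rfl⟩

end RankSet

/-! ### Counting parameters of iterated products. -/

section Parametrization

/-- A set of vectors covered by a polynomial map in `k` parameters. -/
def IsParametrizedBy {ι K : Type} [Field K] (S : Set (ι → K)) (k : ℕ) : Prop :=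
  ∃ (τ : Type) (_ : Fintype τ) (φ : ι → MvPolynomial τ K), Fintype.card τ = k ∧
    ∀ v ∈ S, ∃ t, v = fun i => eval t (φ i)

variable {ι K I J : Type} [Field K]

theorem IsParametrizedBy.image2_mul {S T : Set (ι → K)} {k l : ℕ} (hS : IsParametrizedBy S k)
    (hT : IsParametrizedBy T l) : IsParametrizedBy (Set.image2 (· * ·) S T) (k + l) := by
  obtain ⟨τ, _, φ, rfl, hφ⟩ := hS
  obtain ⟨σ, _, ψ, rfl, hψ⟩ := hT
  refine ⟨τ ⊕ σ, inferInstance, fun i => rename Sum.inl (φ i) * rename Sum.inr (ψ i),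
    Fintype.card_sum, ?_⟩
  rintro _ ⟨v, hv, w, hw, rfl⟩
  obtain ⟨t, rfl⟩ := hφ v hv
  obtain ⟨u, rfl⟩ := hψ w hw
  refine ⟨Sum.elim t u, ?_⟩
  ext i
  simp [eval_rename, Function.comp_def]

theorem IsParametrizedBy.image_bordered {i₀ : I} {j₀ : J}
    {T : Set ({i // i ≠ i₀} × {j // j ≠ j₀} → K)} {k : ℕ} (hT : IsParametrizedBy T k) :
    IsParametrizedBy (bordered i₀ j₀ '' T) k := by
  classical
  obtain ⟨τ, _, φ, rfl, hφ⟩ := hT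
  refine ⟨τ, inferInstance, fun p => 1 + if h : p.1 ≠ i₀ ∧ p.2 ≠ j₀ then
    φ (⟨p.1, h.1⟩, ⟨p.2, h.2⟩) else 0, rfl, ?_⟩
  rintro _ ⟨v, hv, rfl⟩
  obtain ⟨t, rfl⟩ := hφ v hv
  refine ⟨t, ?_⟩
  ext p
  simp only [bordered, map_add, map_one]
  split_ifs <;> simp

theorem isParametrizedBy_graphSet [Fintype J] {q : Type} [Fintype q] {r : ℕ}
    (e : I ≃ Fin r ⊕ q) :
    IsParametrizedBy (graphSet K J e) (Fintype.card q * r + r * Fintype.card J) := by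
  refine ⟨q × Fin r ⊕ Fin r × J, inferInstance, fun p => Sum.elim (fun k => X (Sum.inr (k, p.2)))
    (fun i' => ∑ k, X (Sum.inl (i', k)) * X (Sum.inr (k, p.2))) (e p.1), by simp, ?_⟩
  rintro v ⟨M, N, h⟩
  refine ⟨Sum.elim (fun p => M p.1 p.2) (fun p => N p.1 p.2), ?_⟩
  ext ⟨i, j⟩
  rw [h]
  dsimp only
  rcases e i with k | i' <;> simp

/-- The set of products of an element of `A` and `s` elements of `B`. -/
def iteratedProduct (A B : Set (ι → K)) : ℕ → Set (ι → K)
  | 0 => A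
  | s + 1 => Set.image2 (· * ·) (iteratedProduct A B s) B

theorem IsParametrizedBy.iteratedProduct {A B : Set (ι → K)} {k l : ℕ}
    (hA : IsParametrizedBy A k) (hB : IsParametrizedBy B l) (s : ℕ) :
    IsParametrizedBy (iteratedProduct A B s) (k + s * l) := by
  induction s with
  | zero =>
    rw [zero_mul, add_zero]
    exact hA
  | succ s ih =>
    have := ih.image2_mul hB
    rwa [add_assoc, ← Nat.succ_mul] at this

theorem IsScalingClosed.image2_mul {S T : Set (ι → K)} (hS : IsScalingClosed S) :
    IsScalingClosed (Set.image2 (· * ·) S T) := by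
  rintro a _ ⟨v, hv, w, hw, rfl⟩
  exact ⟨a • v, hS a v hv, w, hw, smul_mul_assoc a v w⟩

theorem IsScalingClosed.iteratedProduct {A B : Set (ι → K)} (hA : IsScalingClosed A) (s : ℕ) :
    IsScalingClosed (iteratedProduct A B s) := by
  induction s with
  | zero => exact hA
  | succ s ih => exact ih.image2_mul

theorem mul_mem_iteratedProduct {A B D : Set (ι → K)} (h : ∀ v ∈ A, ∀ d ∈ D, v * d ∈ A) (s : ℕ)
    {v d : ι → K} (hv : v ∈ iteratedProduct A B s) (hd : d ∈ D) :
    v * d ∈ iteratedProduct A B s := by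
  induction s generalizing v with
  | zero => exact h v hv d hd
  | succ s ih =>
    obtain ⟨u, hu, b, hb, rfl⟩ := hv
    exact ⟨u * d, ih hu, b, hb, mul_right_comm u d b⟩

/-- If `A` is stable under `D` and lies in the closure of `D * B`, then a product of elements
of `A` can be normalized so that all factors but the first lie in `B`. -/
theorem iteratedProduct_subset_zariskiHull {A B D G : Set (ι → K)}
    (hAG : A ⊆ zariskiHull G) (hAD : ∀ v ∈ A, ∀ d ∈ D, v * d ∈ A)
    (hADB : A ⊆ zariskiHull (Set.image2 (· * ·) D B)) (s : ℕ) :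
    iteratedProduct A A s ⊆ zariskiHull (iteratedProduct G B s) := by
  have h1 : iteratedProduct A A s ⊆ zariskiHull (iteratedProduct A B s) := by
    induction s with
    | zero => exact subset_zariskiHull A
    | succ s ih =>
      rintro _ ⟨u, hu, a, ha, rfl⟩
      refine zariskiHull_mono ?_ (mul_mem_zariskiHull_mul (ih hu) (hADB ha))
      rintro _ ⟨x, hx, _, ⟨d, hd, b, hb, rfl⟩, rfl⟩
      -- The factor `d` is absorbed into the earlier product, where it ends up in the initial
      -- element of `A`.
      exact ⟨x * d, mul_mem_iteratedProduct hAD s hx hd, b, hb, mul_assoc x d b⟩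
  refine h1.trans (zariskiHull_subset ?_)
  clear h1
  induction s with
  | zero => exact hAG
  | succ s ih =>
    rintro _ ⟨u, hu, b, hb, rfl⟩
    exact mul_mem_zariskiHull_mul (ih hu) (subset_zariskiHull B hb)

end Parametrization

/-! ### The upper bound for Hadamard powers of rank loci. -/

namespace ProjSpace

theorem hadamard_subset_projHull {K ι : Type*} [Field K] [Infinite K] {X Y : Set (ProjSpace K ι)}
    {S T : Set (ι → K)} (hS : IsScalingClosed S) (hT : IsScalingClosed T) (hX : X ⊆ projHull S)
    (hY : Y ⊆ projHull T) : hadamard X Y ⊆ projHull (Set.image2 (· * ·) S T) := by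
  have hST : IsScalingClosed (Set.image2 (· * ·) S T) := by
    rintro a _ ⟨v, hv, w, hw, rfl⟩
    exact ⟨a • v, hS a v hv, w, hw, smul_mul_assoc a v w⟩
  refine closure_minimal ?_ (isClosed_projHull hST)
  rintro _ ⟨a, b, ha, hb, hab, haX, hbY, rfl⟩
  rw [mk_mem_projHull hST]
  exact mul_mem_zariskiHull_mul ((mk_mem_projHull hS a ha).mp (hX haX))
    ((mk_mem_projHull hT b hb).mp (hY hbY))

theorem projHull_mono {K ι : Type*} [Field K] {S T : Set (ι → K)} (h : S ⊆ T) :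
    projHull S ⊆ projHull T := fun _ hp => zariskiHull_mono h hp

section RankLocus

variable {K : Type} [Field K] {m n r : ℕ}

theorem mem_rankSet_of_rank_le (A : Matrix (Fin m) (Fin n) K) (hA : A.rank ≤ r) :
    (fun ij : Fin m × Fin n => A ij.1 ij.2) ∈ rankSet K (Fin m) (Fin n) r := by
  let W := LinearMap.range A.mulVecLin
  let b := Module.finBasis K W
  have hW : Module.finrank K W ≤ r := hA
  let Q : Fin n → W := fun j => ⟨A.mulVecLin (Pi.single j 1), LinearMap.mem_range_self _ _⟩
  refine ⟨fun i k => if h : (k : ℕ) < Module.finrank K W then (b ⟨k, h⟩ : Fin m → K) i else 0,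
    fun k j => if h : (k : ℕ) < Module.finrank K W then b.repr (Q j) ⟨k, h⟩ else 0,
    fun i j => ?_⟩
  have h1 : A i j = ∑ k, (b k : Fin m → K) i * b.repr (Q j) k := by
    have h2 := congrFun (congrArg Subtype.val (b.sum_repr (Q j))) i
    have h3 : (Q j : Fin m → K) i = A i j := by simp [Q]
    rw [h3] at h2
    rw [← h2, Submodule.coe_sum, Finset.sum_apply]
    exact Finset.sum_congr rfl fun k _ => mul_comm _ _
  change A i j = _
  rw [h1, ← Fintype.sum_of_injective (Fin.castLE hW) (Fin.castLE_injective hW)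
    (fun k => (b k : Fin m → K) i * b.repr (Q j) k)]
  · intro k hk
    have : ¬ (k : ℕ) < Module.finrank K W := fun h => hk ⟨⟨k, h⟩, rfl⟩
    simp [this]
  · intro k
    simp

theorem rank_le_of_mem_rankSet {v : Fin m × Fin n → K}
    (hv : v ∈ rankSet K (Fin m) (Fin n) r) :
    (Matrix.of fun i j => v (i, j)).rank ≤ r := by
  obtain ⟨P, Q, h⟩ := hv
  have : (Matrix.of fun i j => v (i, j)) = Matrix.of P * Matrix.of Q := by
    ext i j
    rw [Matrix.mul_apply]
    exact h i j
  rw [this]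
  exact (Matrix.rank_mul_le_left _ _).trans (Matrix.rank_le_width _)

theorem mk_mem_rankLocus {v : Fin m × Fin n → K} (hv0 : v ≠ 0)
    (hv : v ∈ rankSet K (Fin m) (Fin n) r) : mk v hv0 ∈ rankLocus K m n r :=
  ⟨Matrix.of fun i j => v (i, j), hv0, rank_le_of_mem_rankSet hv, rfl⟩

theorem rankLocus_subset_projHull : rankLocus K m n r ⊆ projHull (rankSet K (Fin m) (Fin n) r) := by
  rintro _ ⟨A, hA, hr, rfl⟩
  rw [mk_mem_projHull (isScalingClosed_rankSet r)]
  exact subset_zariskiHull _ (mem_rankSet_of_rank_le A hr)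

theorem hadamardPow_rankLocus_subset [Infinite K] (s : ℕ) :
    hadamardPow (rankLocus K m n r) (s + 1) ⊆
      projHull (iteratedProduct (rankSet K (Fin m) (Fin n) r)
        (rankSet K (Fin m) (Fin n) r) s) := by
  induction s with
  | zero =>
    -- The constant vectors form the cone over the zeroth power.
    have hc : IsScalingClosed (Set.range fun a : K => fun _ : Fin m × Fin n => a) := by
      rintro a _ ⟨b, rfl⟩
      exact ⟨a * b, rfl⟩
    refine (hadamard_subset_projHull (isScalingClosed_rankSet r) hc rankLocus_subset_projHull
      (?_ : hadamardPow _ 0 ⊆ _)).trans (projHull_mono ?_)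
    · rintro _ ⟨h, rfl⟩
      rw [mk_mem_projHull hc]
      exact subset_zariskiHull _ ⟨1, rfl⟩
    · rintro _ ⟨v, hv, _, ⟨a, rfl⟩, rfl⟩
      exact mul_mem_rankSet hv (const_mem_outerSet a)
  | succ s ih =>
    refine (hadamard_subset_projHull (isScalingClosed_rankSet r)
      ((isScalingClosed_rankSet r).iteratedProduct s) rankLocus_subset_projHull ih).trans
      (projHull_mono ?_)
    rintro _ ⟨v, hv, w, hw, rfl⟩
    exact ⟨w, hw, v, hv, mul_comm w v⟩

theorem one_mem_hadamardPow_rankLocus (hr : 1 ≤ r) (h1 : (1 : Fin m × Fin n → K) ≠ 0) (s : ℕ) :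
    mk 1 h1 ∈ hadamardPow (rankLocus K m n r) s := by
  induction s with
  | zero => exact ⟨h1, rfl⟩
  | succ s ih =>
    exact subset_closure ⟨1, 1, h1, h1, by rwa [one_mul],
      mk_mem_rankLocus h1 (one_mem_rankSet hr), ih, by simp only [one_mul]⟩

/-- The upper bound for the dimension of the Hadamard powers with positive exponent. -/
theorem topologicalKrullDim_hadamardPow_rankLocus_le [Infinite K] (a q b s : ℕ) :
    topologicalKrullDim (hadamardPow (rankLocus K (a + q + 1) (b + 1) (a + 1)) (s + 1)) ≤
      (((a + 1) * (q + b) + a + s * (a * (q + b)) : ℕ) : WithBot ℕ∞) := by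
  -- Here the rank bound is `a + 1`, and `q` rows remain beyond the `a + 1` basic ones. Deleting row
  -- `0` and lowering the rank bound to `a` leaves the same `q`.
  let e : Fin (a + q + 1) ≃ Fin (a + 1) ⊕ Fin q :=
    Fintype.equivOfCardEq (by simp; omega)
  let e' : {i : Fin (a + q + 1) // i ≠ 0} ≃ Fin a ⊕ Fin q :=
    Fintype.equivOfCardEq (by simp)
  let G := graphSet K (Fin (b + 1)) e
  let B := bordered (0 : Fin (a + q + 1)) (0 : Fin (b + 1)) ''
    graphSet K {j : Fin (b + 1) // j ≠ 0} e'
  have hB : rankSet K (Fin (a + q + 1)) (Fin (b + 1)) (a + 1) ⊆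
      zariskiHull (Set.image2 (· * ·) (outerSet K _ _) B) := by
    refine (rankSet_succ_subset_zariskiHull 0 0).trans (zariskiHull_subset ?_)
    rintro _ ⟨d, hd, _, ⟨w, hw, rfl⟩, rfl⟩
    exact mul_mem_zariskiHull_mul (subset_zariskiHull _ hd)
      (bordered_mem_zariskiHull (rankSet_subset_zariskiHull_graphSet e' hw))
  have hsub := iteratedProduct_subset_zariskiHull (rankSet_subset_zariskiHull_graphSet e)
    (fun v hv d hd => mul_mem_rankSet hv hd) hB s
  obtain ⟨τ, _, φ, hτ, hφ⟩ := (isParametrizedBy_graphSet (K := K) (J := Fin (b + 1))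
    e).iteratedProduct (isParametrizedBy_graphSet (K := K)
      (J := {j : Fin (b + 1) // j ≠ 0}) e').image_bordered s
  refine topologicalKrullDim_le_of_parametrized
    ((isScalingClosed_graphSet e).iteratedProduct s) φ hφ ?_
    ((hadamardPow_rankLocus_subset s).trans fun p hp => zariskiHull_subset hsub hp)
  rw [hτ]
  simp
  ring_nf
  rfl

end RankLocus

end ProjSpace

/-! ### Lower bounds for dimension from chains of irreducible sets. -/

namespace ProjSpace

/-- The points of projective space that come from a set of vectors. -/
def pointsOf {K ι : Type*} [Field K] (W : Set (ι → K)) : Set (ProjSpace K ι) :=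
  {p | ∃ (v : ι → K) (hv : v ≠ 0), v ∈ W ∧ p = mk v hv}

theorem isPreirreducible_pointsOf {K ι τ : Type*} [Field K] [Infinite K] {W : Set (ι → K)}
    (φ : ι → MvPolynomial τ K) (hφ : W = Set.range fun t i => eval t (φ i)) :
    IsPreirreducible (pointsOf W) := by
  rw [isPreirreducible_iff_isClosed_union_isClosed]
  intro Z₁ Z₂ h₁ h₂ hsub
  rw [isClosed_iff] at h₁ h₂
  obtain ⟨S₁, hS₁, rfl⟩ := h₁
  obtain ⟨S₂, hS₂, rfl⟩ := h₂
  by_contra! hc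
  have aux : ∀ S : Set (MvPolynomial ι K), (∀ f ∈ S, ∃ d : ℕ, f.IsHomogeneous d) →
      ¬ pointsOf W ⊆ zeroLocus S → ∃ v ∈ W, v ≠ 0 ∧ ∃ f ∈ S, eval v f ≠ 0 := by
    intro S hS h
    rw [Set.not_subset] at h
    obtain ⟨_, ⟨v, hv, hvW, rfl⟩, hn⟩ := h
    rw [mk_mem_zeroLocus hS] at hn
    push Not at hn
    exact ⟨v, hvW, hv, hn⟩
  obtain ⟨v, hvW, hv, f, hf, hfv⟩ := aux S₁ hS₁ hc.1
  obtain ⟨w, hwW, -, g, hg, hgw⟩ := aux S₂ hS₂ hc.2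
  obtain ⟨i, hi⟩ := Function.ne_iff.mp hv
  rw [hφ] at hvW hwW
  obtain ⟨t, rfl⟩ := hvW
  obtain ⟨u, rfl⟩ := hwW
  -- The factor `φ i` ensures that the common point of nonvanishing maps to a nonzero vector.
  have hne : bind₁ φ f * bind₁ φ g * φ i ≠ 0 := by
    refine mul_ne_zero (mul_ne_zero (fun h => hfv ?_) fun h => hgw ?_) fun h => hi ?_
    · rw [← eval_bind₁_eq, h, map_zero]
    · rw [← eval_bind₁_eq, h, map_zero]
    · simp [h]
  obtain ⟨x, hx⟩ : ∃ x, eval x (bind₁ φ f * bind₁ φ g * φ i) ≠ 0 := by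
    by_contra! h
    exact hne (funext fun x => by rw [h, map_zero])
  simp only [map_mul, mul_ne_zero_iff, eval_bind₁_eq] at hx
  have hx0 : (fun i => eval x (φ i)) ≠ 0 := fun h => hx.2 (congrFun h i)
  rcases hsub ⟨_, hx0, hφ ▸ ⟨x, rfl⟩, rfl⟩ with h | h
  · exact hx.1.1 ((mk_mem_zeroLocus hS₁ _ _).mp h f hf)
  · exact hx.1.2 ((mk_mem_zeroLocus hS₂ _ _).mp h g hg)

theorem isClosed_coordinate {K ι : Type*} [Field K] (i : ι) :
    IsClosed (zeroLocus {(X i : MvPolynomial ι K)}) :=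
  (isClosed_iff _).mpr ⟨_, by rintro _ rfl; exact ⟨1, isHomogeneous_X K i⟩, rfl⟩

theorem mk_mem_coordinate {K ι : Type*} [Field K] (i : ι) (v : ι → K) (hv : v ≠ 0) :
    mk v hv ∈ zeroLocus {(X i : MvPolynomial ι K)} ↔ v i = 0 := by
  rw [mk_mem_zeroLocus (by rintro _ rfl; exact ⟨1, isHomogeneous_X K i⟩)]
  simp

theorem isPreirreducible_preimage_val {α : Type*} [TopologicalSpace α] {X Y : Set α} (h : Y ⊆ X)
    (hY : IsPreirreducible Y) : IsPreirreducible (Subtype.val ⁻¹' Y : Set X) := by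
  rw [isPreirreducible_iff_isClosed_union_isClosed] at hY ⊢
  intro Z₁ Z₂ h₁ h₂ hsub
  obtain ⟨C₁, hC₁, rfl⟩ := isClosed_induced_iff.mp h₁
  obtain ⟨C₂, hC₂, rfl⟩ := isClosed_induced_iff.mp h₂
  exact (hY C₁ C₂ hC₁ hC₂ fun p hp => hsub (show (⟨p, h hp⟩ : X) ∈ Subtype.val ⁻¹' Y from hp)).imp
    (fun h' x hx => h' hx) (fun h' x hx => h' hx)

/-- A sequence of irreducible sets of points in `X` whose ascent is detected by the vanishing
of coordinates bounds the dimension of `X` from below. -/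
theorem le_topologicalKrullDim_of_chain {K ι : Type*} [Field K] {X : Set (ProjSpace K ι)} (d : ℕ)
    (W : Fin (d + 1) → Set (ι → K)) (hmono : Monotone W) (c : Fin (d + 1) → ι)
    (hirr : ∀ l, IsPreirreducible (pointsOf (W l))) (hX : ∀ l, pointsOf (W l) ⊆ X)
    (hne : ∀ l, ∃ v ∈ W l, v (c l) ≠ 0) (hzero : ∀ l l', l < l' → ∀ v ∈ W l, v (c l') = 0) :
    (d : WithBot ℕ∞) ≤ topologicalKrullDim X := by
  have hpt : ∀ l, ∃ v, ∃ hv : v ≠ 0, v ∈ W l ∧ v (c l) ≠ 0 := fun l => by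
    obtain ⟨v, hvW, hv⟩ := hne l
    exact ⟨v, fun h => hv (by rw [h]; rfl), hvW, hv⟩
  let Y : Fin (d + 1) → Set X := fun l => Subtype.val ⁻¹' pointsOf (W l)
  have hYirr : ∀ l, IsIrreducible (closure (Y l)) := fun l => by
    refine IsIrreducible.closure ⟨?_, isPreirreducible_preimage_val (hX l) (hirr l)⟩
    obtain ⟨v, hv, hvW, -⟩ := hpt l
    exact ⟨⟨mk v hv, hX l ⟨v, hv, hvW, rfl⟩⟩, v, hv, hvW, rfl⟩
  have hY : ∀ l l', l < l' → closure (Y l) ⊂ closure (Y l') := by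
    intro l l' hl
    refine ⟨closure_mono ?_, fun hle => ?_⟩
    · rintro x ⟨v, hv, hvW, hx⟩
      exact ⟨v, hv, hmono hl.le hvW, hx⟩
    · obtain ⟨v, hv, hvW, hvc⟩ := hpt l'
      have hvY : (⟨mk v hv, hX l' ⟨v, hv, hvW, rfl⟩⟩ : X) ∈ Y l' := ⟨v, hv, hvW, rfl⟩
      have h1 : (⟨mk v hv, hX l' ⟨v, hv, hvW, rfl⟩⟩ : X) ∈ closure (Y l) :=
        hle (subset_closure hvY)
      have hcl : IsClosed (Subtype.val ⁻¹' zeroLocus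
          {(MvPolynomial.X (c l') : MvPolynomial ι K)} : Set X) :=
        (isClosed_coordinate _).preimage continuous_subtype_val
      have h2 : Y l ⊆ Subtype.val ⁻¹' zeroLocus
          {(MvPolynomial.X (c l') : MvPolynomial ι K)} := by
        rintro ⟨p, hp⟩ ⟨w, hw, hwW, hpw⟩
        change p = mk w hw at hpw
        subst hpw
        exact (mk_mem_coordinate _ w hw).mpr (hzero l l' hl w hwW)
      have h3 := Set.mem_preimage.mp (closure_minimal h2 hcl h1)
      exact hvc ((mk_mem_coordinate _ v hv).mp h3)
  let Z : Fin (d + 1) → TopologicalSpace.IrreducibleCloseds X := fun l =>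
    TopologicalSpace.IrreducibleCloseds.mk (closure (Y l)) (hYirr l) isClosed_closure
  have hZ : StrictMono Z := fun l l' h => hY l l' h
  have h := Order.krullDim_le_of_strictMono Z hZ
  refine le_trans ?_ h
  exact Order.LTSeries.length_le_krullDim (LTSeries.mk d id strictMono_id)

/-! ### A maximal chain in the rank locus. -/

section Staircase

variable {K : Type*} [Field K] {m n r : ℕ}

/-- The products of a lower and an upper trapezoidal matrix with supports in `E`. -/
def trapezoidalProducts (K : Type*) [Field K] (m n r : ℕ) (E : Set (ℕ × ℕ)) :
    Set (Fin m × Fin n → K) :=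
  {v | ∃ (P : Fin m → Fin r → K) (Q : Fin r → Fin n → K),
    (∀ i k, P i k ≠ 0 → (k : ℕ) ≤ i ∧ ((i : ℕ), (k : ℕ)) ∈ E) ∧
    (∀ k j, Q k j ≠ 0 → (k : ℕ) ≤ j ∧ ((k : ℕ), (j : ℕ)) ∈ E) ∧
    ∀ i j, v (i, j) = ∑ k, P i k * Q k j}

theorem trapezoidalProducts_mono {E F : Set (ℕ × ℕ)} (h : E ⊆ F) :
    trapezoidalProducts K m n r E ⊆ trapezoidalProducts K m n r F := by
  rintro v ⟨P, Q, hP, hQ, hv⟩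
  exact ⟨P, Q, fun i k h' => (hP i k h').imp_right fun x => h x,
    fun k j h' => (hQ k j h').imp_right fun x => h x, hv⟩

theorem isPreirreducible_trapezoidalProducts [Infinite K] (E : Set (ℕ × ℕ)) :
    IsPreirreducible (pointsOf (trapezoidalProducts K m n r E)) := by
  classical
  let φ : Fin m × Fin n → MvPolynomial (Fin m × Fin r ⊕ Fin r × Fin n) K := fun p => ∑ k : Fin r,
    (if (k : ℕ) ≤ p.1 ∧ ((p.1 : ℕ), (k : ℕ)) ∈ E then X (Sum.inl (p.1, k)) else 0) *
    (if (k : ℕ) ≤ p.2 ∧ ((k : ℕ), (p.2 : ℕ)) ∈ E then X (Sum.inr (k, p.2)) else 0)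
  have hφ : ∀ t p, eval t (φ p) = ∑ k : Fin r,
      (if (k : ℕ) ≤ p.1 ∧ ((p.1 : ℕ), (k : ℕ)) ∈ E then t (Sum.inl (p.1, k)) else 0) *
      (if (k : ℕ) ≤ p.2 ∧ ((k : ℕ), (p.2 : ℕ)) ∈ E then t (Sum.inr (k, p.2)) else 0) := by
    intro t p
    simp only [φ, map_sum, map_mul]
    refine Finset.sum_congr rfl fun k _ => ?_
    congr 1 <;> split_ifs <;> simp
  refine isPreirreducible_pointsOf φ ?_
  ext v
  constructor
  · rintro ⟨P, Q, hP, hQ, hv⟩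
    refine ⟨Sum.elim (fun p => P p.1 p.2) (fun p => Q p.1 p.2), ?_⟩
    ext ⟨i, j⟩
    dsimp only
    rw [hφ, hv]
    refine Finset.sum_congr rfl fun k _ => ?_
    congr 1
    · split_ifs with h
      · rfl
      · exact (not_not.mp (mt (hP i k) h)).symm
    · split_ifs with h
      · rfl
      · exact (not_not.mp (mt (hQ k j) h)).symm
  · rintro ⟨t, rfl⟩
    refine ⟨fun i k => if (k : ℕ) ≤ i ∧ ((i : ℕ), (k : ℕ)) ∈ E then t (Sum.inl (i, k)) else 0,
      fun k j => if (k : ℕ) ≤ j ∧ ((k : ℕ), (j : ℕ)) ∈ E then t (Sum.inr (k, j)) else 0,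
      fun i k h => ?_, fun k j h => ?_, fun i j => hφ t (i, j)⟩
    · by_contra hc
      exact h (if_neg hc)
    · by_contra hc
      exact h (if_neg hc)

theorem pointsOf_trapezoidalProducts_subset {K : Type} [Field K] (E : Set (ℕ × ℕ)) :
    pointsOf (trapezoidalProducts K m n r E) ⊆ rankLocus K m n r := by
  rintro _ ⟨v, hv, ⟨P, Q, -, -, h⟩, rfl⟩
  exact mk_mem_rankLocus hv ⟨P, Q, h⟩

/-- Matrix positions are ordered by decreasing distance from the first row or column, and
lexicographically for equal distances. -/
def staircaseKey (p : ℕ × ℕ) : ℕᵒᵈ ×ₗ (ℕ ×ₗ ℕ) :=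
  toLex (OrderDual.toDual (min p.1 p.2), toLex p)

theorem staircaseKey_injective : Function.Injective staircaseKey := by
  intro p q h
  have h1 := congrArg (fun x => ofLex (ofLex x).2) h
  exact h1

theorem min_le_of_staircaseKey_le {p q : ℕ × ℕ} (h : staircaseKey p ≤ staircaseKey q) :
    min q.1 q.2 ≤ min p.1 p.2 := by
  rw [staircaseKey, staircaseKey, Prod.Lex.toLex_le_toLex] at h
  rcases h with h | ⟨h, -⟩
  · exact (OrderDual.toDual_lt_toDual.mp h).le
  · exact (OrderDual.toDual_inj.mp h).ge

theorem staircaseKey_diagonal_le (p : ℕ × ℕ) :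
    staircaseKey (min p.1 p.2, min p.1 p.2) ≤ staircaseKey p := by
  rw [staircaseKey, staircaseKey, Prod.Lex.toLex_le_toLex]
  refine Or.inr ⟨by simp, ?_⟩
  rw [Prod.Lex.toLex_le_toLex]
  obtain ⟨i, j⟩ := p
  dsimp only
  omega

/-- The positions up to `p` in the staircase order. -/
def staircase (p : ℕ × ℕ) : Set (ℕ × ℕ) := {q | staircaseKey q ≤ staircaseKey p}

/-- A nonzero term with index `k` needs `k ≤ min i j`, while the order of the keys forces `min i j ≤
k`. So one of the two factors sits at position `(i, j)` itself, which is outside the staircase. -/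
theorem trapezoidalProducts_staircase_eq_zero {p : ℕ × ℕ} {i : Fin m} {j : Fin n}
    (h : staircaseKey p < staircaseKey (i, j)) {v : Fin m × Fin n → K}
    (hv : v ∈ trapezoidalProducts K m n r (staircase p)) : v (i, j) = 0 := by
  obtain ⟨P, Q, hP, hQ, hv⟩ := hv
  rw [hv]
  refine Finset.sum_eq_zero fun k _ => ?_
  by_contra hc
  obtain ⟨hc1, hc2⟩ := mul_ne_zero_iff.mp hc
  obtain ⟨h1, h2⟩ := hP i k hc1
  obtain ⟨h3, h4⟩ := hQ k j hc2
  have h5 := min_le_of_staircaseKey_le (h2.trans h.le)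
  simp only at h5
  have h6 : (i : ℕ) = k ∨ (j : ℕ) = k := by omega
  rcases h6 with h6 | h6
  · rw [← h6] at h4
    exact absurd h (not_lt.mpr h4)
  · rw [← h6] at h2
    exact absurd h (not_lt.mpr h2)

/-- The matrix unit at `(i, j)` factors through the index `min i j`: one factor sits at `(i, j)`,
the other on the diagonal, at a position that does not come later. -/
theorem exists_mem_trapezoidalProducts_staircase {i : Fin m} {j : Fin n}
    (h : min (i : ℕ) j < r) :
    ∃ v ∈ trapezoidalProducts K m n r (staircase (i, j)), v (i, j) ≠ 0 := by
  let k₀ : Fin r := ⟨min (i : ℕ) j, h⟩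
  have hmem : (((i : ℕ), (k₀ : ℕ)) ∈ staircase (i, j)) ∧
      (((k₀ : ℕ), (j : ℕ)) ∈ staircase (i, j)) := by
    have hd := staircaseKey_diagonal_le ((i : ℕ), (j : ℕ))
    rcases le_total (i : ℕ) j with hij | hij
    · have hk : (k₀ : ℕ) = i := min_eq_left hij
      rw [hk]
      simp only [min_eq_left hij] at hd
      exact ⟨hd, le_refl (staircaseKey _)⟩
    · have hk : (k₀ : ℕ) = j := min_eq_right hij
      rw [hk]
      simp only [min_eq_right hij] at hd
      exact ⟨le_refl (staircaseKey _), hd⟩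
  refine ⟨fun p => ∑ k, (if p.1 = i ∧ k = k₀ then 1 else 0) *
    (if k = k₀ ∧ p.2 = j then 1 else 0), ⟨fun i' k => if i' = i ∧ k = k₀ then 1 else 0,
    fun k j' => if k = k₀ ∧ j' = j then 1 else 0, fun i' k h' => ?_, fun k j' h' => ?_,
    fun i' j' => ?_⟩, ?_⟩
  · obtain ⟨rfl, rfl⟩ : i' = i ∧ k = k₀ := by
      by_contra hc
      exact h' (if_neg hc)
    exact ⟨min_le_left _ _, hmem.1⟩
  · obtain ⟨rfl, rfl⟩ : k = k₀ ∧ j' = j := by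
      by_contra hc
      exact h' (if_neg hc)
    exact ⟨min_le_right _ _, hmem.2⟩
  · rfl
  · simp

/-- The excluded positions form an `(m - r) × (n - r)` block, so the count is the dimension of the
cone over the rank locus when `r ≤ min m n`. -/
theorem card_filter_min_lt (m n r : ℕ) :
    ((Finset.univ : Finset (Fin m × Fin n)).filter fun p => min (p.1 : ℕ) p.2 < r).card +
      (m - r) * (n - r) = m * n := by
  have h1 := Finset.card_filter_add_card_filter_not (s := (Finset.univ : Finset (Fin m × Fin n)))
    (fun p => min (p.1 : ℕ) p.2 < r)
  have h2 : ∀ l : ℕ,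
      ((Finset.univ : Finset (Fin l)).filter fun i : Fin l => r ≤ (i : ℕ)).card = l - r := by
    intro l
    have h3 := Finset.card_filter_add_card_filter_not (s := (Finset.univ : Finset (Fin l)))
      (fun i : Fin l => (i : ℕ) < r)
    rw [Fin.card_filter_val_lt, Finset.card_univ, Fintype.card_fin] at h3
    simp only [not_lt] at h3
    omega
  have h3 : ((Finset.univ : Finset (Fin m × Fin n)).filter fun p => ¬ min (p.1 : ℕ) p.2 < r) =
      (Finset.univ.filter fun i : Fin m => r ≤ (i : ℕ)) ×ˢ
        (Finset.univ.filter fun j : Fin n => r ≤ (j : ℕ)) := by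
    ext p
    simp
  rw [h3, Finset.card_product, h2, h2, Finset.card_univ, Fintype.card_prod, Fintype.card_fin,
    Fintype.card_fin] at h1
  exact h1

/-- The lower bound for the dimension of the locus of matrices of rank at most `r`. -/
theorem le_topologicalKrullDim_rankLocus {K : Type} [Field K] [Infinite K] {d : ℕ}
    (hd : d + 1 + (m - r) * (n - r) = m * n) :
    (d : WithBot ℕ∞) ≤ topologicalKrullDim (rankLocus K m n r) := by
  let f : Fin m × Fin n → ℕᵒᵈ ×ₗ (ℕ ×ₗ ℕ) := fun p => staircaseKey (p.1, p.2)
  have hf : Function.Injective f := fun p q h => by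
    have := Prod.ext_iff.mp (staircaseKey_injective h)
    exact Prod.ext (Fin.ext this.1) (Fin.ext this.2)
  let S := (Finset.univ : Finset (Fin m × Fin n)).filter fun p => min (p.1 : ℕ) p.2 < r
  have hS : (S.image f).card = d + 1 := by
    rw [Finset.card_image_of_injective _ hf]
    have : S.card + (m - r) * (n - r) = m * n := card_filter_min_lt m n r
    omega
  let g := (S.image f).orderEmbOfFin hS
  have hg : ∀ l, ∃ p : Fin m × Fin n, min (p.1 : ℕ) p.2 < r ∧ f p = g l := fun l => by
    obtain ⟨p, hp, hpl⟩ := Finset.mem_image.mp (Finset.orderEmbOfFin_mem (S.image f) hS l)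
    exact ⟨p, (Finset.mem_filter.mp hp).2, hpl⟩
  choose c hc hcg using hg
  have hlt : ∀ l l', l < l' → f (c l) < f (c l') := fun l l' h => by
    rw [hcg, hcg]
    exact g.strictMono h
  refine le_topologicalKrullDim_of_chain d
    (fun l => trapezoidalProducts K m n r (staircase ((c l).1, (c l).2))) ?_ c
    (fun l => isPreirreducible_trapezoidalProducts _)
    (fun l => pointsOf_trapezoidalProducts_subset _)
    (fun l => exists_mem_trapezoidalProducts_staircase (hc l))
    fun l l' h v hv => trapezoidalProducts_staircase_eq_zero (hlt l l' h) hv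
  intro l l' h
  refine trapezoidalProducts_mono fun q hq => le_trans (b := staircaseKey _) hq ?_
  rcases h.eq_or_lt with rfl | h
  · exact le_rfl
  · exact (hlt l l' h).le

end Staircase

end ProjSpace

/-! ### Finiteness of the dimensions and the final comparison. -/

namespace ProjSpace

theorem topologicalKrullDim_projSpace_le {K ι : Type} [Field K] [Infinite K] [Fintype ι] :
    topologicalKrullDim (ProjSpace K ι) ≤ (Fintype.card ι : WithBot ℕ∞) := by
  have h1 : IsScalingClosed (Set.univ : Set (ι → K)) := fun _ _ _ => trivial
  have h2 := topologicalKrullDim_le_of_parametrized (d := Fintype.card ι) h1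
    (fun i => MvPolynomial.X i) (fun v _ => ⟨v, by simp⟩) (Nat.le_succ _) (X := Set.univ)
    fun p _ => subset_zariskiHull Set.univ trivial
  exact (Homeomorph.Set.univ _).symm.isInducing.topologicalKrullDim_le.trans h2

theorem exists_topologicalKrullDim_eq {α : Type*} [TopologicalSpace α] {X : Set α}
    (hX : X.Nonempty) {d : ℕ} (hd : topologicalKrullDim X ≤ d) :
    ∃ k : ℕ, topologicalKrullDim X = k ∧ k ≤ d := by
  obtain ⟨p, hp⟩ := hX
  have h0 : (0 : WithBot ℕ∞) ≤ topologicalKrullDim X :=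
    Order.LTSeries.length_le_krullDim (LTSeries.mk 0 (fun _ => (⟨closure {⟨p, hp⟩},
      isIrreducible_singleton.closure, isClosed_closure⟩ :
        TopologicalSpace.IrreducibleCloseds X)) fun a b h => absurd h (by omega))
  obtain ⟨e, he⟩ := WithBot.ne_bot_iff_exists.mp (fun h => by simp [h] at h0 :
    topologicalKrullDim X ≠ ⊥)
  rw [← he] at hd ⊢
  have hd' : e ≤ (d : ℕ∞) := by exact_mod_cast hd
  lift e to ℕ using ne_top_of_le_ne_top (ENat.natCast_ne_top d) hd'
  exact ⟨e, rfl, by exact_mod_cast hd'⟩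

theorem rankLocus_subset_hadamardPow_one {K : Type} [Field K] {m n r : ℕ} :
    rankLocus K m n r ⊆ hadamardPow (rankLocus K m n r) 1 := by
  rintro _ ⟨A, hA, hr, rfl⟩
  have h1 : (1 : Fin m × Fin n → K) ≠ 0 := fun h => hA (by
    ext p
    exact absurd (congrFun h p) one_ne_zero)
  exact subset_closure ⟨_, 1, hA, h1, by rwa [mul_one], ⟨A, hA, hr, rfl⟩, ⟨h1, rfl⟩,
    by simp only [mul_one]⟩

theorem topologicalKrullDim_rankLocus_le_hadamardPow_one {K : Type} [Field K] {m n r : ℕ} :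
    topologicalKrullDim (rankLocus K m n r) ≤
      topologicalKrullDim (hadamardPow (rankLocus K m n r) 1) :=
  (Topology.IsEmbedding.inclusion
    rankLocus_subset_hadamardPow_one).isInducing.topologicalKrullDim_le

end ProjSpace

open ProjSpace in
theorem mainTheorem10 (m n r : ℕ) (hr : 1 ≤ r) (hrmn : r ≤ min m n) (s : ℕ) :
    ∃ dPow dr d1 dP : ℕ,
      topologicalKrullDim (ProjSpace.hadamardPow (ProjSpace.rankLocus ℂ m n r) s) = dPow ∧
      topologicalKrullDim (ProjSpace.rankLocus ℂ m n r) = dr ∧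
      topologicalKrullDim (ProjSpace.rankLocus ℂ m n 1) = d1 ∧
      topologicalKrullDim (ProjSpace ℂ (Fin m × Fin n)) = dP ∧
      (dPow : ℤ) ≤ min ((s : ℤ) * dr - ((s : ℤ) - 1) * d1) dP := by
  obtain ⟨a, rfl⟩ := Nat.exists_eq_add_of_le' hr
  obtain ⟨q, rfl⟩ : ∃ q, m = a + q + 1 := ⟨m - (a + 1), by omega⟩
  obtain ⟨b, rfl⟩ : ∃ b, n = b + 1 := ⟨n - 1, by omega⟩
  have hab : a ≤ b := by omega
  have h1 : (1 : Fin (a + q + 1) × Fin (b + 1) → ℂ) ≠ 0 := one_ne_zero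
  have hone : ∀ r, 1 ≤ r → (rankLocus ℂ (a + q + 1) (b + 1) r).Nonempty := fun r hr =>
    ⟨_, mk_mem_rankLocus h1 (one_mem_rankSet hr)⟩
  have hrank : topologicalKrullDim (rankLocus ℂ (a + q + 1) (b + 1) (a + 1)) ≤
      (((a + 1) * (q + b) + a : ℕ) : WithBot ℕ∞) := by
    have h2 := topologicalKrullDim_hadamardPow_rankLocus_le (K := ℂ) a q b 0
    rw [zero_mul, add_zero] at h2
    exact topologicalKrullDim_rankLocus_le_hadamardPow_one.trans h2
  have hrank1 : topologicalKrullDim (rankLocus ℂ (a + q + 1) (b + 1) 1) ≤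
      ((a + q + b : ℕ) : WithBot ℕ∞) := by
    -- Rank one is the case `a = 0`, with the remaining `a + q` rows as the new `q`.
    have h2 := topologicalKrullDim_hadamardPow_rankLocus_le (K := ℂ) 0 (a + q) b 0
    rw [Nat.zero_add (a + q), Nat.zero_add 1, Nat.zero_mul, one_mul, add_zero] at h2
    exact topologicalKrullDim_rankLocus_le_hadamardPow_one.trans h2
  have hlow : (((a + 1) * (q + b) + a : ℕ) : WithBot ℕ∞) ≤
      topologicalKrullDim (rankLocus ℂ (a + q + 1) (b + 1) (a + 1)) := by
    refine le_topologicalKrullDim_rankLocus ?_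
    obtain ⟨c, rfl⟩ := Nat.exists_eq_add_of_le hab
    have e1 : a + q + 1 - (a + 1) = q := by omega
    have e2 : a + c + 1 - (a + 1) = c := by omega
    rw [e1, e2]
    ring
  obtain ⟨dr, hdr, hdr'⟩ := exists_topologicalKrullDim_eq (hone _ hr) hrank
  obtain ⟨d1, hd1, hd1'⟩ := exists_topologicalKrullDim_eq (hone 1 le_rfl) hrank1
  have hPn : (Set.univ : Set (ProjSpace ℂ (Fin (a + q + 1) × Fin (b + 1)))).Nonempty :=
    ⟨mk 1 h1, trivial⟩
  have huniv : topologicalKrullDim (Set.univ : Set (ProjSpace ℂ (Fin (a + q + 1) × Fin (b + 1)))) =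
      topologicalKrullDim (ProjSpace ℂ (Fin (a + q + 1) × Fin (b + 1))) :=
    IsHomeomorph.topologicalKrullDim_eq _ (Homeomorph.Set.univ _).isHomeomorph
  obtain ⟨dP, hdP, -⟩ := exists_topologicalKrullDim_eq hPn
    (huniv.le.trans topologicalKrullDim_projSpace_le)
  rw [huniv] at hdP
  have hlow' : (a + 1) * (q + b) + a ≤ dr := by
    rw [hdr] at hlow
    exact_mod_cast hlow
  have hpow : ∃ B : ℕ, topologicalKrullDim
      (hadamardPow (rankLocus ℂ (a + q + 1) (b + 1) (a + 1)) s) ≤ (B : WithBot ℕ∞) ∧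
      (B : ℤ) ≤ (s : ℤ) * dr - ((s : ℤ) - 1) * d1 := by
    cases s with
    | zero =>
      -- For `s = 0` the right-hand side is `d1`, and the point `[1 : ⋯ : 1]` has rank one.
      refine ⟨d1, ?_, by simp⟩
      rw [← hd1]
      refine (Topology.IsEmbedding.inclusion ?_).isInducing.topologicalKrullDim_le
      rintro _ ⟨h, rfl⟩
      exact mk_mem_rankLocus h (one_mem_rankSet le_rfl)
    | succ s =>
      refine ⟨_, topologicalKrullDim_hadamardPow_rankLocus_le a q b s, ?_⟩
      have e1 : (((a + 1) * (q + b) + a : ℕ) : ℤ) ≤ dr := by exact_mod_cast hlow'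
      have e2 : (d1 : ℤ) ≤ (a + q + b : ℕ) := by exact_mod_cast hd1'
      -- Only a lower bound for `dr` and an upper bound for `d1` are needed; the difference of these
      -- two bounds is `a * (q + b)`, the cost of one more factor.
      have e3 : (0 : ℤ) ≤ s * ((dr - ((a + 1) * (q + b) + a : ℕ)) + ((a + q + b : ℕ) - d1)) :=
        mul_nonneg (by positivity) (by linarith)
      push_cast at e1 e2 e3 ⊢
      linarith
  obtain ⟨B, hB, hB'⟩ := hpow
  obtain ⟨dPow, hdPow, hle⟩ :=
    exists_topologicalKrullDim_eq ⟨_, one_mem_hadamardPow_rankLocus hr h1 s⟩ hB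
  refine ⟨dPow, dr, d1, dP, hdPow, hdr, hd1, hdP, le_min ?_ ?_⟩
  · exact le_trans (by exact_mod_cast hle) hB'
  · have := topologicalKrullDim_subspace_le _
      (hadamardPow (rankLocus ℂ (a + q + 1) (b + 1) (a + 1)) s)
    rw [hdPow, hdP] at this
    exact_mod_cast this
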